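/- Let $n\ge 1$, $r>0$, and for $x_0\in\mathbb{R}^n$ let $\mathfrak{B}_r(x_0)$ be the open Euclidean ball of radius $r$ centred at $x_0$; put $\mathfrak{B}_r=\mathfrak{B}_r(0)$. For a bounded domain (nonempty connected open set) $\Omega\subset\mathbb{R}^n$ let $$\lambda^D_{1,\infty}(\Omega)=\inf\{\|\nabla u\|_{L^\infty(\Omega)} : u\in W^{1,\infty}_0(\Omega),\ \|u\|_{L^\infty(\Omega)}=1\},$$ $$\lambda^N_{1,\infty}(\Omega)=\inf\{\|\nabla u\|_{L^\infty(\Omega)} : u\in W^{1,\infty}(\Omega),\ \sup_\Omega u=-\inf_\Omega u=1\},$$ where $W^{1,\infty}_0(\Omega)$ consists of the $u\in W^{1,\infty}(\Omega)$ that are continuous on $\overline\Omega$ and vanish on $\partial\Omega$. A normalized Dirichlet $\infty$-ground state of $\Omega$ is a function $u\in C(\overline\Omega)$ with $\|u\|_{L^\infty(\Omega)}=1$ that satisfies, with $\Delta_\infty u=\nabla u^{T}D^2u\,\nabla u$, $$\min\{-\Delta_\infty u,\ |\nabla u|-\lambda^D_{1,\infty}(\Omega)\,u\}=0 \ \text{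 in } \Omega \text{ (in the viscosity sense)},\qquad u=0\ \text{ on } \partial\Omega.$$ **Theorem.** For every $x_0\in\mathbb{R}^n$ the function $x\mapsto 1-|x-x_0|/r$ is a normalized Dirichlet $\infty$-ground state of $\mathfrak{B}_r(x_0)$. Moreover, for every $\varepsilon>0$ there are $\delta_1,\delta_2>0$, depending only on $\varepsilon$, $n$ and $r$, with the following property. Let $\Omega\subset\mathbb{R}^n$ be a bounded domain whose Lebesgue measure equals that of $\mathfrak{B}_r$, with $$|\lambda^D_{1,\infty}(\Omega)-\lambda^D_{1,\infty}(\mathfrak{B}_r)|<\delta_1\quad\text{and}\quad|\lambda^N_{1,\infty}(\Omega)-\lambda^N_{1,\infty}(\mathfrak{B}_r)|<\delta_2,$$ and let $x_0\in\Omega$ be the centre of any largest ball contained in $\Omega$, that is, a point where $\mathrm{dist}(\cdot,\partial\Omega)$ attains its maximum over $\Omega$. Then every normalized Dirichlet $\infty$-ground state $u$ of $\Omega$ satisfies $$\Big|u(x)-\Big(1-\frac{|x-x_0|}{r}\Big)\Big|<\varepsilon\quad\text{for all } x\in\Omega\cap\mathfrak{B}_r(x_0).$$ In particular, if $\Omega$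 is translated so that a largest inscribed ball is centred at the origin, then $|u(x)-(1-|x|/r)|<\varepsilon$ on $\Omega\cap\mathfrak{B}_r$. -/

import Mathlib

open MeasureTheory Set Metric Topology
open scoped ENNReal ContDiff Gradient

/-- `ℝⁿ` with the Euclidean norm. -/
abbrev RN (n : ℕ) : Type := EuclideanSpace ℝ (Fin n)

/-- `u` belongs to `W^{1,∞}(Ω)` and `g` is its weak gradient: both are essentially bounded on `Ω`
and `∫_Ω u ∂_v φ = - ∫_Ω φ ⟨g, v⟩` for all test functions `φ ∈ C_c^∞(Ω)` and all directions `v`. -/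
def IsW1Infty {n : ℕ} (Ω : Set (RN n)) (u : RN n → ℝ) (g : RN n → RN n) : Prop :=
  MemLp u ∞ (volume.restrict Ω) ∧ MemLp g ∞ (volume.restrict Ω) ∧
    ∀ φ : RN n → ℝ, ContDiff ℝ ∞ φ → HasCompactSupport φ → tsupport φ ⊆ Ω →
      ∀ v : RN n, ∫ x in Ω, u x * fderiv ℝ φ x v = -∫ x in Ω, φ x * inner ℝ (g x) v

/-- `u` belongs to `W^{1,∞}_0(Ω)` and `g` is its weak gradient: `u ∈ W^{1,∞}(Ω)` is (represented by)
a function continuous on `closure Ω` that vanishes on the boundary. -/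
def IsW1InftyZero {n : ℕ} (Ω : Set (RN n)) (u : RN n → ℝ) (g : RN n → RN n) : Prop :=
  IsW1Infty Ω u g ∧ ContinuousOn u (closure Ω) ∧ ∀ x ∈ frontier Ω, u x = 0

/-- The first Dirichlet `∞`-eigenvalue: the infimum of `‖∇u‖_{L^∞(Ω)}` over all
`u ∈ W^{1,∞}_0(Ω)` with `‖u‖_{L^∞(Ω)} = 1`. -/
noncomputable def dirichletInftyEigenvalue {n : ℕ} (Ω : Set (RN n)) : ℝ :=
  sInf {L : ℝ | ∃ (u : RN n → ℝ) (g : RN n → RN n), IsW1InftyZero Ω u g ∧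
    eLpNorm u ∞ (volume.restrict Ω) = 1 ∧ L = (eLpNorm g ∞ (volume.restrict Ω)).toReal}

/-- The first nontrivial Neumann `∞`-eigenvalue: the infimum of `‖∇u‖_{L^∞(Ω)}` over all
`u ∈ W^{1,∞}(Ω)` with `sup_Ω u = - inf_Ω u = 1` (essential bounds, as `u` is defined a.e.). -/
noncomputable def neumannInftyEigenvalue {n : ℕ} (Ω : Set (RN n)) : ℝ :=
  sInf {L : ℝ | ∃ (u : RN n → ℝ) (g : RN n → RN n), IsW1Infty Ω u g ∧
    essSup u (volume.restrict Ω) = 1 ∧ essInf u (volume.restrict Ω) = -1 ∧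
    L = (eLpNorm g ∞ (volume.restrict Ω)).toReal}

/-- The `∞`-Laplacian `Δ_∞ φ = ∇φᵀ D²φ ∇φ` (used for `φ` of class `C²` near `x`). -/
noncomputable def inftyLaplacian {n : ℕ} (φ : RN n → ℝ) (x : RN n) : ℝ :=
  fderiv ℝ (fderiv ℝ φ) x (∇ φ x) (∇ φ x)

/-- Viscosity subsolution of `min {-Δ_∞ u, |∇u| - Λ u} = 0` in the open set `Ω`. -/
def IsViscositySubsolution {n : ℕ} (Λ : ℝ) (Ω : Set (RN n)) (u : RN n → ℝ) : Prop :=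
  ∀ x ∈ Ω, ∀ φ : RN n → ℝ, ContDiffAt ℝ 2 φ x → IsLocalMax (fun y => u y - φ y) x →
    min (-inftyLaplacian φ x) (‖∇ φ x‖ - Λ * u x) ≤ 0

/-- Viscosity supersolution of `min {-Δ_∞ u, |∇u| - Λ u} = 0` in the open set `Ω`. -/
def IsViscositySupersolution {n : ℕ} (Λ : ℝ) (Ω : Set (RN n)) (u : RN n → ℝ) : Prop :=
  ∀ x ∈ Ω, ∀ φ : RN n → ℝ, ContDiffAt ℝ 2 φ x → IsLocalMin (fun y => u y - φ y) x →
    0 ≤ min (-inftyLaplacian φ x) (‖∇ φ x‖ - Λ * u x)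

/-- A normalized Dirichlet `∞`-ground state of `Ω`: a function, continuous on `closure Ω`, with
`‖u‖_{L^∞(Ω)} = 1`, that solves `min {-Δ_∞ u, |∇u| - λ u} = 0` in `Ω` in the viscosity sense, with
`λ` the first Dirichlet `∞`-eigenvalue of `Ω`, and `u = 0` on the boundary. -/
structure IsNormalizedGroundState {n : ℕ} (Ω : Set (RN n)) (u : RN n → ℝ) : Prop where
  continuousOn : ContinuousOn u (closure Ω)
  boundary : ∀ x ∈ frontier Ω, u x = 0
  norm_eq_one : eLpNorm u ∞ (volume.restrict Ω) = 1
  subsolution : IsViscositySubsolution (dirichletInftyEigenvalue Ω) Ω u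
  supersolution : IsViscositySupersolution (dirichletInftyEigenvalue Ω) Ω u

/-- `x₀` is the centre of a largest ball contained in `Ω`: a point of `Ω` at which the distance
to the boundary is maximal. -/
def IsIncenter {n : ℕ} (Ω : Set (RN n)) (x₀ : RN n) : Prop :=
  x₀ ∈ Ω ∧ ∀ y ∈ Ω, infDist y (frontier Ω) ≤ infDist x₀ (frontier Ω)

/-! The two eigenvalues control two lengths. A linear function in the direction `y - z`, rescaled to
have supremum 1 and infimum -1, shows that the Neumann eigenvalue is at most `2 / ‖y - z‖`. If it is
nearly at least `1 / r`, the diameter `M` of `Ω` is hardly more than `2r`. The Dirichlet eigenvalue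
`Λ` is the slope of the barriers for a ground state `u`. Comparison with nearly linear radial
functions gives `u ≤ Λ dist(·, ∂Ω)`, so at a point `c` with `u c = 1` the distance to the boundary
is at least `1/Λ`, hence also at the incenter `x₀`.

Two balls of radius `1/Λ` in a set of diameter at most `M ≈ 2/Λ` almost coincide: `‖x₀ - c‖ ≤ M -
2/Λ`. Moreover `Ω` lies within `M - 1/Λ` of `x₀`. The cone at `c` bounds `u` from below. The upper
bound follows by prolonging the ray from `x₀` through `x` to the boundary. Both bounds are `1 - Λ‖x
- x₀‖` up to `ΛM - 2` (`IsNormalizedGroundState.bounds`). For the ball itself the cone is tested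
directly, with `Λ = 1 / r` from `dirichletInftyEigenvalue_ball`. -/

/-! ### Weak gradients and Lipschitz bounds -/

/-- A function that is continuous on an open set and a.e. bounded above there is bounded above
everywhere there. -/
theorem ContinuousOn.le_of_ae_restrict_le {n : ℕ} {Ω : Set (RN n)} (hΩ : IsOpen Ω) {f : RN n → ℝ}
    (hf : ContinuousOn f Ω) {c : ℝ} (h : ∀ᵐ x ∂volume.restrict Ω, f x ≤ c) :
    ∀ x ∈ Ω, f x ≤ c := by
  intro x hx
  by_contra! hc
  have ho : IsOpen (Ω ∩ f ⁻¹' Ioi c) := hf.isOpen_inter_preimage hΩ isOpen_Ioi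
  have hpos := ho.measure_pos volume ⟨x, hx, hc⟩
  rw [ae_restrict_iff' hΩ.measurableSet, ae_iff] at h
  refine hpos.ne' (measure_mono_null ?_ h)
  rintro y ⟨hy, hyc⟩
  simpa [hy] using hyc

theorem MeasureTheory.MemLp.ae_norm_le_toReal_eLpNorm_top {α E : Type*} [MeasurableSpace α]
    [NormedAddCommGroup E] {μ : Measure α} {f : α → E} (hf : MemLp f ∞ μ) :
    ∀ᵐ x ∂μ, ‖f x‖ ≤ (eLpNorm f ∞ μ).toReal := by
  have h := ae_le_eLpNormEssSup (f := f) (μ := μ)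
  rw [← eLpNorm_exponent_top] at h
  filter_upwards [h] with x hx
  rw [← toReal_enorm]
  exact ENNReal.toReal_mono hf.2.ne hx

theorem IsW1Infty.integrable_indicator {n : ℕ} {Ω : Set (RN n)} (hΩ : IsOpen Ω)
    (hb : Bornology.IsBounded Ω) {u : RN n → ℝ} {g : RN n → RN n} (h : IsW1Infty Ω u g) :
    Integrable (Ω.indicator u) := by
  have : IsFiniteMeasure (volume.restrict Ω) :=
    ⟨by simpa using hb.measure_lt_top⟩
  exact (integrable_indicator_iff hΩ.measurableSet).2 (h.1.integrable le_top)

/-- A mollification of a `W^{1,∞}` function has gradient bounded by the bound for the weak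
gradient, at points far enough from the boundary. -/
theorem IsW1Infty.exists_hasFDerivAt_convolution {n : ℕ} {Ω : Set (RN n)} (hΩ : IsOpen Ω)
    (hb : Bornology.IsBounded Ω) {u : RN n → ℝ} {g : RN n → RN n} (h : IsW1Infty Ω u g)
    {L : ℝ} (hL0 : 0 ≤ L) (hL : ∀ᵐ x ∂volume.restrict Ω, ‖g x‖ ≤ L)
    (φ : ContDiffBump (0 : RN n)) {x : RN n} (hx : closedBall x φ.rOut ⊆ Ω) :
    ∃ F : RN n →L[ℝ] ℝ, ‖F‖ ≤ L ∧ HasFDerivAt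
      (convolution (φ.normed volume) (Ω.indicator u) (ContinuousLinearMap.lsmul ℝ ℝ) volume)
        F x := by
  have hw := h.integrable_indicator hΩ hb
  have hφ : ContDiff ℝ ∞ (φ.normed volume) := φ.contDiff_normed
  have hcs : HasCompactSupport (φ.normed volume) := φ.hasCompactSupport_normed
  refine ⟨_, ?_, hcs.hasFDerivAt_convolution_left (ContinuousLinearMap.lsmul ℝ ℝ)
    (hφ.of_le (by simp)) hw.locallyIntegrable x⟩
  refine ContinuousLinearMap.opNorm_le_bound _ hL0 fun v => ?_
  -- The reflected, translated bump is a test function in `Ω` by `hx`; the weak gradient identity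
  -- for it turns the derivative of the mollification into an average of `⟨g, v⟩`.
  set ψ : RN n → ℝ := fun t => φ.normed volume (x - t) with hψ
  have hψd : ContDiff ℝ ∞ ψ := hφ.comp (contDiff_const.sub contDiff_id)
  have hψt : Function.support ψ ⊆ closedBall x φ.rOut := by
    intro t ht
    have : x - t ∈ Function.support (φ.normed volume) := ht
    rw [φ.support_normed_eq] at this
    rw [mem_closedBall, dist_comm, dist_eq_norm]
    simpa using (mem_ball.1 this).le
  have hψt' : tsupport ψ ⊆ closedBall x φ.rOut := closure_minimal hψt isClosed_closedBall
  have hψc : HasCompactSupport ψ :=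
    HasCompactSupport.of_support_subset_isCompact (isCompact_closedBall x _) hψt
  have hψf : ∀ t, fderiv ℝ ψ t v = - fderiv ℝ (φ.normed volume) (x - t) v := by
    intro t
    have h1 : HasFDerivAt (fun t : RN n => x - t) (-ContinuousLinearMap.id ℝ (RN n)) t := by
      simpa using (hasFDerivAt_id t).const_sub x
    have h2 := ((hφ.differentiable (by simp)) (x - t)).hasFDerivAt.comp t h1
    rw [HasFDerivAt.fderiv (f := ψ) h2]
    simp
  have hint : Integrable ψ := (hψd.continuous).integrable_of_hasCompactSupport hψc
  have key : (convolution (fderiv ℝ (φ.normed volume)) (Ω.indicator u)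
      ((ContinuousLinearMap.lsmul ℝ ℝ).precompL (RN n)) volume x) v
      = ∫ t in Ω, ψ t * inner ℝ (g t) v := by
    have hex := (hcs.fderiv ℝ).convolutionExists_left
      ((ContinuousLinearMap.lsmul ℝ ℝ).precompL (RN n)) (hφ.continuous_fderiv (by simp))
      hw.locallyIntegrable x
    rw [convolution_eq_swap, ContinuousLinearMap.integral_apply hex.integrable_swap,
      ← neg_eq_iff_eq_neg.2 (h.2.2 ψ hψd hψc (hψt'.trans hx) v), ← integral_neg,
      ← integral_indicator hΩ.measurableSet]
    congr 1
    ext t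
    by_cases ht : t ∈ Ω
    · simp [ht, hψf, mul_comm]
    · simp [ht]
  rw [key]
  calc ‖∫ t in Ω, ψ t * inner ℝ (g t) v‖ ≤ ∫ t in Ω, ψ t * (L * ‖v‖) := by
        refine norm_integral_le_of_norm_le (hint.integrableOn.mul_const _) ?_
        filter_upwards [hL] with t ht
        rw [norm_mul, Real.norm_of_nonneg (φ.nonneg_normed _)]
        refine mul_le_mul_of_nonneg_left ?_ (φ.nonneg_normed _)
        exact (norm_inner_le_norm _ _).trans (by gcongr)
    _ = (∫ t in Ω, ψ t) * (L * ‖v‖) := integral_mul_const _ _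
    _ ≤ 1 * (L * ‖v‖) := by
        gcongr
        refine (setIntegral_le_integral hint (.of_forall fun t => φ.nonneg_normed _)).trans ?_
        rw [hψ, integral_sub_left_eq_self (φ.normed volume) volume x, φ.integral_normed]
    _ = L * ‖v‖ := one_mul _

/-- A function in `W^{1,∞}` of a ball is a.e. Lipschitz, with the bound of its weak gradient as
the Lipschitz constant. -/
theorem IsW1Infty.ae_lipschitz_ball {n : ℕ} {c : RN n} {r : ℝ} {u : RN n → ℝ} {g : RN n → RN n}
    (h : IsW1Infty (ball c r) u g) {L : ℝ} (hL0 : 0 ≤ L)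
    (hL : ∀ᵐ x ∂volume.restrict (ball c r), ‖g x‖ ≤ L) :
    ∃ N : Set (RN n), volume N = 0 ∧ ∀ x ∈ ball c r \ N, ∀ y ∈ ball c r \ N,
      |u x - u y| ≤ L * ‖x - y‖ := by
  -- The fixed ratio 2 between outer and inner radius is what makes the mollifications converge
  -- almost everywhere.
  let φ : ℕ → ContDiffBump (0 : RN n) := fun k =>
    ⟨1 / ((k : ℝ) + 1) / 2, 1 / ((k : ℝ) + 1), by positivity,
      half_lt_self (by positivity)⟩
  have hφ0 : Filter.Tendsto (fun k => (φ k).rOut) Filter.atTop (𝓝 0) :=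
    tendsto_one_div_add_atTop_nhds_zero_nat
  have hae := ContDiffBump.ae_convolution_tendsto_right_of_locallyIntegrable (μ := volume)
    (φ := φ) (K := 2) hφ0
    (.of_forall fun k => by change 1 / ((k : ℝ) + 1) ≤ 2 * (1 / ((k : ℝ) + 1) / 2); linarith)
    (h.integrable_indicator isOpen_ball isBounded_ball).locallyIntegrable
  refine ⟨_, hae, ?_⟩
  rintro x ⟨hx, hxN⟩ y ⟨hy, hyN⟩
  simp only [mem_compl_iff, mem_ofPred_eq, not_not] at hxN hyN
  rw [indicator_of_mem hx] at hxN
  rw [indicator_of_mem hy] at hyN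
  refine le_of_tendsto (hxN.sub hyN).abs ?_
  -- Both points lie in a smaller concentric ball; there the gradient bound holds for small
  -- mollification radii, and convexity allows the mean value inequality.
  obtain ⟨s, hs, hsr⟩ := exists_between (max_lt (mem_ball.1 hx) (mem_ball.1 hy))
  filter_upwards [hφ0.eventually_lt_const (sub_pos.2 hsr)] with k hk
  have hsub : ∀ z ∈ ball c s, closedBall z (φ k).rOut ⊆ ball c r := fun z hz w hw => by
    rw [mem_ball] at hz ⊢
    rw [mem_closedBall] at hw
    linarith [dist_triangle w z c]
  have hex := fun z (hz : z ∈ ball c s) =>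
    h.exists_hasFDerivAt_convolution isOpen_ball isBounded_ball hL0 hL (φ k) (hsub z hz)
  have := (convex_ball c s).norm_image_sub_le_of_norm_fderiv_le (𝕜 := ℝ)
    (fun z hz => (hex z hz).choose_spec.2.differentiableAt)
    (fun z hz => by
      rw [(hex z hz).choose_spec.2.fderiv]
      exact (hex z hz).choose_spec.1)
    (mem_ball.2 ((le_max_right _ _).trans_lt hs)) (mem_ball.2 ((le_max_left _ _).trans_lt hs))
  simpa [Real.norm_eq_abs] using this

/-- A Lipschitz function belongs to `W^{1,∞}(Ω)` for every bounded open `Ω`, and its gradient is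
bounded by the Lipschitz constant. -/
theorem LipschitzWith.isW1Infty {n : ℕ} {Ω : Set (RN n)} (hΩ : IsOpen Ω)
    (hb : Bornology.IsBounded Ω) {K : NNReal} {u : RN n → ℝ} (hu : LipschitzWith K u) :
    IsW1Infty Ω u (∇ u) ∧ (eLpNorm (∇ u) ∞ (volume.restrict Ω)).toReal ≤ K := by
  have hg : ∀ x, ‖∇ u x‖ ≤ K := fun x => by
    rw [gradient, LinearIsometryEquiv.norm_map]
    exact norm_fderiv_le_of_lipschitz ℝ hu
  have : IsFiniteMeasure (volume.restrict Ω) := ⟨by simpa using hb.measure_lt_top⟩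
  have hgm : Measurable (∇ u) :=
    (InnerProductSpace.toDual ℝ (RN n)).symm.continuous.measurable.comp (measurable_fderiv ℝ u)
  refine ⟨⟨?_, MemLp.of_bound hgm.aestronglyMeasurable K (.of_forall hg), ?_⟩, ?_⟩
  · obtain ⟨C, hC⟩ := (hb.isCompact_closure.image hu.continuous).isBounded.exists_norm_le
    refine MemLp.of_bound hu.continuous.aestronglyMeasurable C ?_
    filter_upwards [ae_restrict_mem hΩ.measurableSet] with x hx
    exact hC _ (mem_image_of_mem _ (subset_closure hx))
  · intro φ hφ hφc hφs v
    obtain ⟨D, hD⟩ := hφ.lipschitzWith_of_hasCompactSupport hφc (by simp)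
    have key := LipschitzWith.integral_lineDeriv_mul_eq (μ := volume) hu hD hφc v
    have e1 : ∫ x in Ω, u x * fderiv ℝ φ x v = ∫ x, u x * fderiv ℝ φ x v := by
      refine setIntegral_eq_integral_of_forall_compl_eq_zero fun x hx => ?_
      have : fderiv ℝ φ x = 0 :=
        Function.notMem_support.1 fun h' => hx (hφs (support_fderiv_subset ℝ h'))
      simp [this]
    have e2 : ∫ x in Ω, φ x * inner ℝ (∇ u x) v = ∫ x, φ x * inner ℝ (∇ u x) v := by
      refine setIntegral_eq_integral_of_forall_compl_eq_zero fun x hx => ?_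
      have : φ x = 0 := image_eq_zero_of_notMem_tsupport fun h' => hx (hφs h')
      simp [this]
    rw [e1, e2, ← integral_neg]
    have f1 : ∫ x, lineDeriv ℝ u x v * φ x = ∫ x, φ x * inner ℝ (∇ u x) v := by
      refine integral_congr_ae ?_
      filter_upwards [hu.ae_differentiableAt (μ := volume)] with x hx
      rw [hx.lineDeriv_eq_fderiv, mul_comm, gradient, InnerProductSpace.toDual_symm_apply]
    have f2 : ∫ x, lineDeriv ℝ φ x (-v) * u x = ∫ x, -(u x * fderiv ℝ φ x v) := by
      congr 1
      ext x
      rw [((hφ.differentiable (by simp)) x).lineDeriv_eq_fderiv]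
      simp [mul_comm]
    rw [f1, f2, integral_neg] at key
    rw [integral_neg, key, neg_neg]
  · refine ENNReal.toReal_le_of_le_ofReal K.2 ?_
    rw [eLpNorm_exponent_top]
    exact eLpNormEssSup_le_of_ae_bound (.of_forall hg)

/-! ### Essential bounds and the Neumann eigenvalue -/

theorem ae_volume_restrict_neBot {n : ℕ} {Ω : Set (RN n)} (hΩ : IsOpen Ω)
    (hne : Ω.Nonempty) : (ae (volume.restrict Ω)).NeBot := by
  rw [ae_neBot, Ne, Measure.restrict_eq_zero]
  exact (hΩ.measure_pos volume hne).ne'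

theorem IsLUB.essSup_eq {n : ℕ} {Ω : Set (RN n)} (hΩ : IsOpen Ω) (hne : Ω.Nonempty)
    {f : RN n → ℝ} (hf : ContinuousOn f Ω) {c : ℝ} (h : IsLUB (f '' Ω) c) :
    essSup f (volume.restrict Ω) = c := by
  have hnb := ae_volume_restrict_neBot hΩ hne
  have hae : ∀ᵐ x ∂volume.restrict Ω, f x ≤ c := by
    filter_upwards [ae_restrict_mem hΩ.measurableSet] with x hx
    exact h.1 (mem_image_of_mem f hx)
  have hle : ∀ a, (∀ᵐ x ∂volume.restrict Ω, f x ≤ a) → c ≤ a := fun a ha =>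
    h.2 (forall_mem_image.2 (hf.le_of_ae_restrict_le hΩ ha))
  rw [essSup, Filter.limsup_eq]
  exact le_antisymm (csInf_le ⟨c, hle⟩ hae) (le_csInf ⟨c, hae⟩ hle)

theorem IsGLB.essInf_eq {n : ℕ} {Ω : Set (RN n)} (hΩ : IsOpen Ω) (hne : Ω.Nonempty)
    {f : RN n → ℝ} (hf : ContinuousOn f Ω) {c : ℝ} (h : IsGLB (f '' Ω) c) :
    essInf f (volume.restrict Ω) = c := by
  have hnb := ae_volume_restrict_neBot hΩ hne
  have hae : ∀ᵐ x ∂volume.restrict Ω, c ≤ f x := by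
    filter_upwards [ae_restrict_mem hΩ.measurableSet] with x hx
    exact h.1 (mem_image_of_mem f hx)
  have hle : ∀ a, (∀ᵐ x ∂volume.restrict Ω, a ≤ f x) → a ≤ c := fun a ha =>
    h.2 (forall_mem_image.2 fun x hx => neg_le_neg_iff.1 <|
      hf.neg.le_of_ae_restrict_le hΩ (ha.mono fun y hy => neg_le_neg hy) x hx)
  rw [essInf, Filter.liminf_eq]
  exact le_antisymm (csSup_le ⟨c, hae⟩ hle) (le_csSup ⟨c, hle⟩ hae)

/-- A rescaled linear function is admissible for the Neumann eigenvalue. -/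
theorem exists_neumann_competitor {n : ℕ} {Ω : Set (RN n)} (hΩ : IsOpen Ω)
    (hb : Bornology.IsBounded Ω) {y z : RN n} (hy : y ∈ Ω) (hz : z ∈ Ω) (hyz : y ≠ z) :
    ∃ (u : RN n → ℝ) (g : RN n → RN n), IsW1Infty Ω u g ∧
      essSup u (volume.restrict Ω) = 1 ∧ essInf u (volume.restrict Ω) = -1 ∧
      (eLpNorm g ∞ (volume.restrict Ω)).toReal ≤ 2 / ‖y - z‖ := by
  have hd : 0 < ‖y - z‖ := norm_pos_iff.2 (sub_ne_zero.2 hyz)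
  set l : RN n → ℝ := fun x => inner ℝ (y - z) x with hl
  have hlc : Continuous l := by fun_prop
  have hlb : Bornology.IsBounded (l '' Ω) :=
    (hb.isCompact_closure.image hlc).isBounded.subset (image_mono subset_closure)
  have hne : (l '' Ω).Nonempty := ⟨_, mem_image_of_mem l hy⟩
  have hS := isLUB_csSup hne hlb.bddAbove
  have hI := isGLB_csInf hne hlb.bddBelow
  set S := sSup (l '' Ω)
  set I := sInf (l '' Ω)
  have hSI : ‖y - z‖ ^ 2 ≤ S - I := by
    have h1 := hS.1 (mem_image_of_mem l hy)
    have h2 := hI.1 (mem_image_of_mem l hz)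
    have h3 : l y - l z = ‖y - z‖ ^ 2 := by
      rw [hl, ← inner_sub_right, real_inner_self_eq_norm_sq]
    linarith
  have hpos : 0 < S - I := lt_of_lt_of_le (by positivity) hSI
  -- The slope is `2‖y - z‖ / (S - I)`, and `S - I ≥ ‖y - z‖ ^ 2`.
  set u : RN n → ℝ := fun x => (2 * l x - S - I) / (S - I) with hu
  have huc : Continuous u := by fun_prop
  have hlip : LipschitzWith (Real.toNNReal (2 / ‖y - z‖)) u := by
    refine LipschitzWith.of_dist_le' fun p q => ?_
    have h1 : u p - u q = 2 / (S - I) * inner ℝ (y - z) (p - q) := by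
      rw [hu, inner_sub_right]
      field_simp
      ring
    rw [Real.dist_eq, h1, abs_mul, abs_of_pos (by positivity), dist_eq_norm]
    calc 2 / (S - I) * |inner ℝ (y - z) (p - q)|
        ≤ 2 / ‖y - z‖ ^ 2 * (‖y - z‖ * ‖p - q‖) := by
          gcongr
          exact abs_real_inner_le_norm _ _
      _ = 2 / ‖y - z‖ * ‖p - q‖ := by field_simp
  have h := hlip.isW1Infty hΩ hb
  refine ⟨u, ∇ u, h.1, ?_, ?_, ?_⟩
  · refine IsLUB.essSup_eq hΩ ⟨y, hy⟩ huc.continuousOn ⟨forall_mem_image.2 fun x hx => ?_,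
      fun b hb => ?_⟩
    · have := hS.1 (mem_image_of_mem l hx)
      rw [hu, div_le_one hpos]
      linarith
    · have : S ≤ (b * (S - I) + S + I) / 2 := hS.2 <| forall_mem_image.2 fun x hx => by
        have := hb (mem_image_of_mem u hx)
        rw [hu, div_le_iff₀ hpos] at this
        linarith
      nlinarith
  · refine IsGLB.essInf_eq hΩ ⟨y, hy⟩ huc.continuousOn ⟨forall_mem_image.2 fun x hx => ?_,
      fun b hb => ?_⟩
    · have := hI.1 (mem_image_of_mem l hx)
      rw [hu, le_div_iff₀ hpos]
      linarith
    · have : (b * (S - I) + S + I) / 2 ≤ I := hI.2 <| forall_mem_image.2 fun x hx => by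
        have := hb (mem_image_of_mem u hx)
        rw [hu, le_div_iff₀ hpos] at this
        linarith
      nlinarith
  · refine h.2.trans_eq (Real.coe_toNNReal _ (by positivity))

/-- A lower bound on the Neumann eigenvalue thereby becomes an upper bound on the diameter. -/
theorem neumannInftyEigenvalue_le {n : ℕ} {Ω : Set (RN n)} (hΩ : IsOpen Ω)
    (hb : Bornology.IsBounded Ω) {y z : RN n} (hy : y ∈ Ω) (hz : z ∈ Ω) (hyz : y ≠ z) :
    neumannInftyEigenvalue Ω ≤ 2 / ‖y - z‖ := by
  obtain ⟨u, g, h, hS, hI, hle⟩ := exists_neumann_competitor hΩ hb hy hz hyz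
  unfold neumannInftyEigenvalue
  refine le_trans (csInf_le ⟨0, ?_⟩ (mem_ofPred.2 ⟨u, g, h, hS, hI, rfl⟩)) hle
  rintro _ ⟨_, _, _, _, _, rfl⟩
  exact ENNReal.toReal_nonneg

/-- Every vector is its norm times a unit vector. -/
theorem exists_unit_smul_eq {n : ℕ} (hn : 1 ≤ n) (w : RN n) :
    ∃ e : RN n, ‖e‖ = 1 ∧ w = ‖w‖ • e := by
  have : NeZero n := ⟨by omega⟩
  by_cases hw : w = 0
  · obtain ⟨e, he⟩ := exists_norm_eq (RN n) zero_le_one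
    exact ⟨e, he, by simp [hw]⟩
  · have := norm_ne_zero_iff.2 hw
    exact ⟨‖w‖⁻¹ • w, by simp [norm_smul, this], by simp [smul_smul, this]⟩

/-- A function with Lipschitz constant `L` oscillates by at most `2rL` on the ball, while the
normalization requires an oscillation of 2. -/
theorem one_div_le_neumannInftyEigenvalue_ball {n : ℕ} (hn : 1 ≤ n) (c : RN n) {r : ℝ}
    (hr : 0 < r) : 1 / r ≤ neumannInftyEigenvalue (ball c r) := by
  have hnb := ae_volume_restrict_neBot (isOpen_ball (x := c) (ε := r)) ⟨c, mem_ball_self hr⟩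
  refine le_csInf ?_ ?_
  -- The infimum of the empty set of reals is 0, so a competitor is needed for the lower bound.
  · obtain ⟨e, he, -⟩ := exists_unit_smul_eq hn (0 : RN n)
    have hne : c + (r / 2) • e ≠ c := by
      rw [Ne, add_eq_left, smul_eq_zero, not_or]
      exact ⟨by positivity, fun h => by simp [h] at he⟩
    obtain ⟨u, g, h, hS, hI, -⟩ := exists_neumann_competitor (isOpen_ball (x := c) (ε := r))
      isBounded_ball (y := c + (r / 2) • e) (z := c)
      (by simp [norm_smul, he, abs_of_pos hr]; linarith) (mem_ball_self hr) hne
    exact ⟨_, u, g, h, hS, hI, rfl⟩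
  · rintro _ ⟨u, g, h, hS, hI, rfl⟩
    set L := (eLpNorm g ∞ (volume.restrict (ball c r))).toReal
    have hL0 : 0 ≤ L := ENNReal.toReal_nonneg
    obtain ⟨N, hN, hlip⟩ := h.ae_lipschitz_ball hL0 h.2.1.ae_norm_le_toReal_eLpNorm_top
    have hae : ∀ᵐ x ∂volume.restrict (ball c r), x ∈ ball c r \ N := by
      filter_upwards [ae_restrict_mem measurableSet_ball,
        ae_restrict_of_ae (measure_eq_zero_iff_ae_notMem.1 hN)] with x h1 h2
      exact ⟨h1, h2⟩
    have hb := h.1.ae_norm_le_toReal_eLpNorm_top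
    set C := (eLpNorm u ∞ (volume.restrict (ball c r))).toReal
    have hdiff : ∀ x ∈ ball c r \ N, ∀ y ∈ ball c r \ N, u x ≤ u y + L * (2 * r) := by
      intro x hx y hy
      have h1 := (le_abs_self _).trans (hlip x hx y hy)
      have h2 : ‖x - y‖ ≤ 2 * r := by
        rw [← dist_eq_norm]
        linarith [dist_triangle_right x y c, mem_ball.1 hx.1, mem_ball.1 hy.1]
      linarith [mul_le_mul_of_nonneg_left h2 hL0]
    have hup : ∀ y ∈ ball c r \ N, 1 - L * (2 * r) ≤ u y := by
      intro y hy
      have : essSup u (volume.restrict (ball c r)) ≤ u y + L * (2 * r) := by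
        rw [essSup, Filter.limsup_eq]
        refine csInf_le ⟨-C, fun a ha => ?_⟩ (hae.mono fun x hx => hdiff x hx y hy)
        obtain ⟨x, h1, h2⟩ := (Filter.Eventually.and (Set.mem_ofPred.1 ha) hb).exists
        exact (abs_le.1 h2).1.trans h1
      linarith
    have : 1 - L * (2 * r) ≤ essInf u (volume.restrict (ball c r)) := by
      rw [essInf, Filter.liminf_eq]
      refine le_csSup ⟨C, fun a ha => ?_⟩ (hae.mono hup)
      obtain ⟨x, h1, h2⟩ := (Filter.Eventually.and (Set.mem_ofPred.1 ha) hb).exists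
      exact le_trans h1 (abs_le.1 h2).2
    rw [div_le_iff₀ hr]
    linarith

/-! ### The Dirichlet eigenvalue of a ball -/

theorem eLpNorm_cone {n : ℕ} (c : RN n) {r : ℝ} (hr : 0 < r) :
    eLpNorm (fun x => 1 - ‖x - c‖ / r) ∞ (volume.restrict (ball c r)) = 1 := by
  have hle : ∀ x ∈ ball c r, ‖1 - ‖x - c‖ / r‖ ≤ 1 := fun x hx => by
    have h1 : ‖x - c‖ / r ≤ 1 := (div_le_one hr).2 (mem_ball_iff_norm.1 hx).le
    have h2 : 0 ≤ ‖x - c‖ / r := by positivity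
    rw [Real.norm_eq_abs, abs_le]
    constructor <;> linarith
  have hae : ∀ᵐ x ∂volume.restrict (ball c r), ‖1 - ‖x - c‖ / r‖ ≤ 1 := by
    filter_upwards [ae_restrict_mem measurableSet_ball] with x hx using hle x hx
  have hcont : Continuous fun x : RN n => 1 - ‖x - c‖ / r := by fun_prop
  have : IsFiniteMeasure (volume.restrict (ball c r)) :=
    ⟨by simpa using (isBounded_ball (x := c) (r := r)).measure_lt_top⟩
  have hm : MemLp (fun x => 1 - ‖x - c‖ / r) ∞ (volume.restrict (ball c r)) :=
    MemLp.of_bound hcont.aestronglyMeasurable 1 hae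
  refine le_antisymm ?_ ?_
  · rw [eLpNorm_exponent_top]
    simpa using eLpNormEssSup_le_of_ae_bound hae
  · have := ContinuousOn.le_of_ae_restrict_le isOpen_ball hcont.norm.continuousOn
      hm.ae_norm_le_toReal_eLpNorm_top c (mem_ball_self hr)
    simp only [sub_self, norm_zero, zero_div, sub_zero, norm_one] at this
    rw [← ENNReal.ofReal_one]
    exact ENNReal.ofReal_le_of_le_toReal this

theorem cone_eq_zero_of_mem_frontier {n : ℕ} {c : RN n} {r : ℝ} (hr : 0 < r) :
    ∀ x ∈ frontier (ball c r), 1 - ‖x - c‖ / r = 0 := by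
  intro x hx
  rw [frontier_ball c hr.ne', mem_sphere_iff_norm] at hx
  rw [hx, div_self hr.ne', sub_self]

theorem exists_dirichlet_competitor_ball {n : ℕ} (c : RN n) {r : ℝ} (hr : 0 < r) :
    ∃ (u : RN n → ℝ) (g : RN n → RN n), IsW1InftyZero (ball c r) u g ∧
      eLpNorm u ∞ (volume.restrict (ball c r)) = 1 ∧
      (eLpNorm g ∞ (volume.restrict (ball c r))).toReal ≤ 1 / r := by
  have hlip : LipschitzWith (Real.toNNReal (1 / r)) fun x : RN n => 1 - ‖x - c‖ / r := by
    refine LipschitzWith.of_dist_le' fun p q => ?_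
    have h1 : 1 - ‖p - c‖ / r - (1 - ‖q - c‖ / r) = 1 / r * (‖q - c‖ - ‖p - c‖) := by ring
    rw [Real.dist_eq, h1, abs_mul, abs_of_pos (by positivity), dist_comm, dist_eq_norm]
    gcongr
    simpa using abs_norm_sub_norm_le (q - c) (p - c)
  have h := hlip.isW1Infty (isOpen_ball (x := c) (ε := r)) isBounded_ball
  exact ⟨_, _, ⟨h.1, hlip.continuous.continuousOn, cone_eq_zero_of_mem_frontier hr⟩,
    eLpNorm_cone c hr, h.2.trans_eq (Real.coe_toNNReal _ (by positivity))⟩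

/-- The cone attains `1 / r`. Conversely, each point of the ball is within `r` of a boundary point,
where a competitor vanishes, so its values are at most `L * r`. -/
theorem dirichletInftyEigenvalue_ball {n : ℕ} (hn : 1 ≤ n) (c : RN n) {r : ℝ} (hr : 0 < r) :
    dirichletInftyEigenvalue (ball c r) = 1 / r := by
  obtain ⟨u, g, h, h1, hle⟩ := exists_dirichlet_competitor_ball c hr
  unfold dirichletInftyEigenvalue
  refine le_antisymm (le_trans (csInf_le ⟨0, ?_⟩ (mem_ofPred.2 ⟨u, g, h, h1, rfl⟩)) hle)
    (le_csInf ⟨_, u, g, h, h1, rfl⟩ ?_)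
  · rintro _ ⟨_, _, _, _, rfl⟩
    exact ENNReal.toReal_nonneg
  · clear h h1 hle u g
    rintro _ ⟨u, g, ⟨h, hc, h0⟩, h1, rfl⟩
    set L := (eLpNorm g ∞ (volume.restrict (ball c r))).toReal
    have hL0 : 0 ≤ L := ENNReal.toReal_nonneg
    obtain ⟨N, hN, hlip⟩ := h.ae_lipschitz_ball hL0 h.2.1.ae_norm_le_toReal_eLpNorm_top
    have hae : ∀ᵐ x ∂volume.restrict (ball c r), x ∈ ball c r \ N := by
      filter_upwards [ae_restrict_mem measurableSet_ball,
        ae_restrict_of_ae (measure_eq_zero_iff_ae_notMem.1 hN)] with x h1 h2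
      exact ⟨h1, h2⟩
    have hcb : ContinuousOn u (ball c r) := hc.mono subset_closure
    -- Continuity removes the exceptional null set from one variable at a time.
    have hlip1 : ∀ y ∈ ball c r \ N, ∀ x ∈ ball c r, |u x - u y| - L * ‖x - y‖ ≤ 0 := by
      intro y hy
      refine ContinuousOn.le_of_ae_restrict_le isOpen_ball
        (((hcb.sub continuousOn_const).abs).sub (by fun_prop)) ?_
      filter_upwards [hae] with x hx using sub_nonpos.2 (hlip x hx y hy)
    have hlip2 : ∀ x ∈ ball c r, ∀ y ∈ ball c r, |u x - u y| - L * ‖x - y‖ ≤ 0 := by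
      intro x hx
      refine ContinuousOn.le_of_ae_restrict_le isOpen_ball
        (((continuousOn_const.sub hcb).abs).sub (by fun_prop)) ?_
      filter_upwards [hae] with y hy using hlip1 y hy x hx
    have hbd : ∀ x ∈ ball c r, ‖u x‖ ≤ L * r := by
      intro x hx
      obtain ⟨e, he, hxe⟩ := exists_unit_smul_eq hn (x - c)
      have hz : c + r • e ∈ frontier (ball c r) := by
        rw [frontier_ball c hr.ne']
        simp [norm_smul, he, abs_of_pos hr]
      have hzc := frontier_subset_closure hz
      have hcl : |u x - u (c + r • e)| - L * ‖x - (c + r • e)‖ ≤ 0 := by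
        have hco : ContinuousOn (fun y => |u x - u y| - L * ‖x - y‖) (closure (ball c r)) :=
          ((continuousOn_const.sub hc).abs).sub (by fun_prop)
        exact le_on_closure (hlip2 x hx) hco continuousOn_const hzc
      have hn' : ‖x - (c + r • e)‖ ≤ r := by
        have : x - (c + r • e) = (‖x - c‖ - r) • e := by
          rw [sub_smul, ← hxe]
          abel
        rw [this, norm_smul, he, mul_one, Real.norm_eq_abs, abs_le]
        have := mem_ball_iff_norm.1 hx
        constructor <;> linarith [norm_nonneg (x - c)]
      rw [h0 _ hz, sub_zero] at hcl
      rw [Real.norm_eq_abs]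
      linarith [mul_le_mul_of_nonneg_left hn' hL0]
    have hle : eLpNorm u ∞ (volume.restrict (ball c r)) ≤ ENNReal.ofReal (L * r) := by
      rw [eLpNorm_exponent_top]
      refine eLpNormEssSup_le_of_ae_bound ?_
      filter_upwards [ae_restrict_mem measurableSet_ball] with x hx using hbd x hx
    rw [h1, ← ENNReal.ofReal_one, ENNReal.ofReal_le_ofReal_iff (by positivity)] at hle
    rwa [div_le_iff₀ hr]

/-! ### Derivatives of test functions -/

/-- Second-order necessary condition at a local minimum on the line. -/
theorem IsLocalMin.nonneg_of_hasDerivAt_hasDerivAt {p q : ℝ → ℝ} {A s₀ : ℝ}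
    (hp : ∀ᶠ s in 𝓝 s₀, HasDerivAt p (q s) s) (hq : HasDerivAt q A s₀) (h : IsLocalMin p s₀) :
    0 ≤ A := by
  by_contra! hA
  have hpq : deriv p =ᶠ[𝓝 s₀] q := hp.mono fun s hs => hs.deriv
  have h2 : deriv (deriv p) s₀ = A := hpq.deriv_eq.trans hq.deriv
  -- With `A < 0` the point would be both a local minimum and a local maximum, so `p` would be
  -- locally constant and `A = 0`.
  have hmax : IsLocalMax p s₀ := isLocalMax_of_deriv_deriv_neg (h2.trans_lt hA) h.deriv_eq_zero
    hp.self_of_nhds.continuousAt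
  have hconst : p =ᶠ[𝓝 s₀] fun _ => p s₀ := by
    filter_upwards [h, hmax] with s h1 h2 using le_antisymm h2 h1
  have hd : deriv p =ᶠ[𝓝 s₀] fun _ => (0 : ℝ) := by
    simpa using hconst.deriv
  have : deriv (deriv p) s₀ = 0 := by simpa using hd.deriv_eq
  linarith

/-- The derivatives of a `C²` function along a ray. -/
theorem ContDiffAt.hasDerivAt_ray {E : Type*} [NormedAddCommGroup E] [NormedSpace ℝ E]
    {φ : E → ℝ} {x : E} (hφ : ContDiffAt ℝ 2 φ x) (v : E) :
    (∀ᶠ s : ℝ in 𝓝 0, HasDerivAt (fun s : ℝ => φ (x + s • v)) (fderiv ℝ φ (x + s • v) v) s) ∧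
      HasDerivAt (fun s : ℝ => fderiv ℝ φ (x + s • v) v) (fderiv ℝ (fderiv ℝ φ) x v v) 0 := by
  have hray : ∀ s : ℝ, HasDerivAt (fun s : ℝ => x + s • v) v s := fun s => by
    simpa using ((hasDerivAt_id s).smul_const v).const_add x
  have ht : Filter.Tendsto (fun s : ℝ => x + s • v) (𝓝 0) (𝓝 x) := by
    simpa using (hray 0).continuousAt.tendsto
  constructor
  · have hev : ∀ᶠ z in 𝓝 x, ContDiffAt ℝ 2 φ z := hφ.eventually (by simp)
    filter_upwards [ht.eventually hev] with s hs
    have hd : DifferentiableAt ℝ φ (x + s • v) := hs.differentiableAt (by simp)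
    exact hd.hasFDerivAt.comp_hasDerivAt s (hray s)
  · have h0 : ContDiffAt ℝ 1 (fderiv ℝ φ) x := hφ.fderiv_right (by norm_num)
    have h1 : HasFDerivAt (fderiv ℝ φ) (fderiv ℝ (fderiv ℝ φ) x) (x + (0 : ℝ) • v) := by
      rw [zero_smul, add_zero]
      exact (h0.differentiableAt one_ne_zero).hasFDerivAt
    have h2 : HasDerivAt (fun s : ℝ => fderiv ℝ φ (x + s • v)) (fderiv ℝ (fderiv ℝ φ) x v) 0 :=
      h1.comp_hasDerivAt 0 (hray 0)
    simpa using h2.clm_apply (hasDerivAt_const 0 v)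

/-- If `u` is affine along a line through `x` and `u - φ` has a local maximum at `x`, then the
second derivative of `φ` along that line is nonnegative. -/
theorem IsLocalMax.fderiv_fderiv_nonneg {n : ℕ} {u φ : RN n → ℝ} {x v : RN n}
    (hφ : ContDiffAt ℝ 2 φ x) (h : IsLocalMax (fun y => u y - φ y) x) {α β : ℝ}
    (hu : ∀ᶠ s : ℝ in 𝓝 0, u (x + s • v) = α + β * s) :
    0 ≤ fderiv ℝ (fderiv ℝ φ) x v v := by
  obtain ⟨h1, h2⟩ := hφ.hasDerivAt_ray v
  have ht : Filter.Tendsto (fun s : ℝ => x + s • v) (𝓝 0) (𝓝 x) :=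
    Continuous.tendsto' (by fun_prop) _ _ (by simp)
  refine IsLocalMin.nonneg_of_hasDerivAt_hasDerivAt
    (p := fun s => φ (x + s • v) - (α + β * s)) (q := fun s => fderiv ℝ φ (x + s • v) v - β)
    (s₀ := 0) ?_ (h2.sub_const β) ?_
  · filter_upwards [h1] with s hs
    have : HasDerivAt (fun s : ℝ => α + β * s) β s := by
      simpa using ((hasDerivAt_id s).const_mul β).const_add α
    exact hs.sub this
  · have hu0 := hu.self_of_nhds
    filter_upwards [ht.eventually h, hu] with s hs hus
    simp only [zero_smul, add_zero] at hu0 ⊢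
    rw [hus, hu0] at hs
    linarith

theorem IsLocalMin.fderiv_fderiv_nonpos {n : ℕ} {u φ : RN n → ℝ} {x v : RN n}
    (hφ : ContDiffAt ℝ 2 φ x) (h : IsLocalMin (fun y => u y - φ y) x) {α β : ℝ}
    (hu : ∀ᶠ s : ℝ in 𝓝 0, u (x + s • v) = α + β * s) :
    fderiv ℝ (fderiv ℝ φ) x v v ≤ 0 := by
  have h' : IsLocalMax (fun y => (-u) y - (-φ) y) x := by
    refine h.neg.congr (.of_forall fun y => ?_)
    simp only [Pi.neg_apply]
    ring
  have := IsLocalMax.fderiv_fderiv_nonneg (v := v) hφ.neg h' (α := -α) (β := -β) (by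
    filter_upwards [hu] with s hs
    rw [Pi.neg_apply, hs]
    ring)
  have e : fderiv ℝ (fun y => -φ y) = fun y => -fderiv ℝ φ y := funext fun y => fderiv_fun_neg
  change 0 ≤ fderiv ℝ (fderiv ℝ (fun y => -φ y)) x v v at this
  rw [e, fderiv_fun_neg] at this
  simpa using this

/-- A function lying above a downward cone with vertex `c` has directional derivatives at `c`
bounded below by the slope of the cone. -/
theorem HasFDerivAt.neg_mul_norm_le {n : ℕ} {φ : RN n → ℝ} {c : RN n} {F : RN n →L[ℝ] ℝ}
    (hφ : HasFDerivAt φ F c) {K : ℝ} (h : ∀ᶠ y in 𝓝 c, φ c - K * ‖y - c‖ ≤ φ y) (w : RN n) :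
    -(K * ‖w‖) ≤ F w := by
  have hray : HasDerivAt (fun s : ℝ => c + s • w) w 0 := by
    simpa using ((hasDerivAt_id (0 : ℝ)).smul_const w).const_add c
  have hφ' : HasFDerivAt φ F (c + (0 : ℝ) • w) := by simpa using hφ
  have hd := (hφ'.comp_hasDerivAt 0 hray).tendsto_slope_zero_right
  have ht : Filter.Tendsto (fun s : ℝ => c + s • w) (𝓝[>] 0) (𝓝 c) :=
    (Continuous.tendsto' (by fun_prop) _ _ (by simp)).mono_left nhdsWithin_le_nhds
  refine ge_of_tendsto hd ?_
  filter_upwards [ht.eventually h, self_mem_nhdsWithin] with s hs hs0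
  have hs0 : 0 < s := hs0
  simp only [Function.comp_apply, zero_add, zero_smul, add_zero, smul_eq_mul]
  rw [le_inv_mul_iff₀ hs0]
  simp only [add_sub_cancel_left, norm_smul, Real.norm_of_nonneg hs0.le] at hs
  linarith

theorem hasFDerivAt_norm_sub {E : Type*} [NormedAddCommGroup E] [InnerProductSpace ℝ E] {x y : E}
    (hx : x ≠ y) : HasFDerivAt (fun x : E => ‖x - y‖) (‖x - y‖⁻¹ • innerSL ℝ (x - y)) x := by
  have hpos : ‖x - y‖ ≠ 0 := norm_ne_zero_iff.2 (sub_ne_zero.2 hx)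
  have h := (((hasFDerivAt_id (𝕜 := ℝ) x).sub_const y).norm_sq).sqrt (by simpa using hpos)
  simp only [Real.sqrt_sq (norm_nonneg _)] at h
  refine h.congr_fderiv ?_
  ext w
  simp
  field_simp

/-! ### Radial quadratic test functions -/

section Radial

variable {n : ℕ} (c₀ a b : ℝ) (y : RN n)

/-- The radial function `c₀ + a t + b t²` of the distance `t` to `y`. -/
noncomputable def radialQuadratic (x : RN n) : ℝ := c₀ + a * ‖x - y‖ + b * ‖x - y‖ ^ 2

theorem continuous_radialQuadratic : Continuous (radialQuadratic c₀ a b y) := by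
  unfold radialQuadratic
  fun_prop

variable {y} {x : RN n}

theorem contDiffAt_radialQuadratic (hx : x ≠ y) : ContDiffAt ℝ 2 (radialQuadratic c₀ a b y) x := by
  have hn : ContDiffAt ℝ 2 (fun x : RN n => ‖x - y‖) x :=
    (contDiffAt_id.sub contDiffAt_const).norm ℝ (sub_ne_zero.2 hx)
  exact (contDiffAt_const.add (contDiffAt_const.mul hn)).add (contDiffAt_const.mul (hn.pow 2))

theorem hasFDerivAt_radialQuadratic (hx : x ≠ y) :
    HasFDerivAt (radialQuadratic c₀ a b y) ((a / ‖x - y‖ + 2 * b) • innerSL ℝ (x - y)) x := by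
  have h2 := hasFDerivAt_norm_sub hx
  refine (((h2.const_mul a).const_add c₀).add ((h2.pow 2).const_mul b)).congr_fderiv ?_
  have hpos : ‖x - y‖ ≠ 0 := norm_ne_zero_iff.2 (sub_ne_zero.2 hx)
  ext1 w
  simp only [add_apply, smul_apply, smul_eq_mul]
  field_simp
  push_cast
  ring

theorem gradient_radialQuadratic (hx : x ≠ y) :
    ∇ (radialQuadratic c₀ a b y) x = (a / ‖x - y‖ + 2 * b) • (x - y) := by
  rw [gradient, (hasFDerivAt_radialQuadratic c₀ a b hx).fderiv, map_smul]
  congr 1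
  rw [LinearIsometryEquiv.symm_apply_eq]
  ext w
  simp

theorem norm_gradient_radialQuadratic (hx : x ≠ y) :
    ‖∇ (radialQuadratic c₀ a b y) x‖ = |a + 2 * b * ‖x - y‖| := by
  have hpos : 0 < ‖x - y‖ := norm_pos_iff.2 (sub_ne_zero.2 hx)
  rw [gradient_radialQuadratic c₀ a b hx, norm_smul, Real.norm_eq_abs]
  nth_rewrite 2 [← abs_of_pos hpos]
  rw [← abs_mul]
  congr 1
  field_simp

/-- For a radial profile `f` this is `f'' (f')²`, so the sign of `b` decides the strict inequality
wherever `f' ≠ 0`. -/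
theorem inftyLaplacian_radialQuadratic (hx : x ≠ y) :
    inftyLaplacian (radialQuadratic c₀ a b y) x = 2 * b * (a + 2 * b * ‖x - y‖) ^ 2 := by
  have hpos : 0 < ‖x - y‖ := norm_pos_iff.2 (sub_ne_zero.2 hx)
  rw [inftyLaplacian, gradient_radialQuadratic c₀ a b hx]
  set t := ‖x - y‖ with ht
  obtain ⟨κ, hκ⟩ : ∃ κ, κ = a / t + 2 * b := ⟨_, rfl⟩
  rw [← hκ]
  have h := ((contDiffAt_radialQuadratic c₀ a b hx).hasDerivAt_ray (κ • (x - y))).2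
  -- The gradient is radial, so only the line through `y` matters; along it the directional
  -- derivative is affine in `s`.
  have hev : (fun s : ℝ => fderiv ℝ (radialQuadratic c₀ a b y) (x + s • κ • (x - y))
      (κ • (x - y))) =ᶠ[𝓝 0] fun s => a * κ * t + 2 * b * κ * t ^ 2 * (1 + κ * s) := by
    have hc : ∀ᶠ s : ℝ in 𝓝 0, 0 < 1 + s * κ :=
      ((by fun_prop : Continuous fun s : ℝ => 1 + s * κ).tendsto' 0 1 (by simp)).eventually_const_lt
        zero_lt_one
    filter_upwards [hc] with s hs
    have e : x + s • κ • (x - y) - y = (1 + s * κ) • (x - y) := by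
      rw [add_smul, one_smul, mul_smul]
      abel
    have en : ‖x + s • κ • (x - y) - y‖ = (1 + s * κ) * t := by
      rw [e, norm_smul, Real.norm_of_nonneg hs.le]
    have hne : x + s • κ • (x - y) ≠ y := by
      rw [← sub_ne_zero, ← norm_ne_zero_iff, en]
      positivity
    rw [(hasFDerivAt_radialQuadratic c₀ a b hne).fderiv, en, e]
    simp only [map_smul, smul_apply, smul_eq_mul, innerSL_apply_apply,
      real_inner_self_eq_norm_sq, ← ht]
    rw [mul_comm κ s]
    generalize 1 + s * κ = d at *
    field_simp
  have h2 : HasDerivAt (fun s : ℝ => a * κ * t + 2 * b * κ * t ^ 2 * (1 + κ * s))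
      (2 * b * κ * t ^ 2 * κ) 0 := by
    simpa using ((((hasDerivAt_id (0 : ℝ)).const_mul κ).const_add 1).const_mul
      (2 * b * κ * t ^ 2)).const_add (a * κ * t)
  rw [h.unique (h2.congr_of_eventuallyEq hev), hκ]
  field_simp

end Radial

/-! ### Rays to the boundary and viscosity comparison -/

/-- A connected set that meets an open set but not its boundary is contained in it. -/
theorem IsPreconnected.subset_of_disjoint_frontier {X : Type*} [TopologicalSpace X] {s Ω : Set X}
    (hs : IsPreconnected s) (hΩ : IsOpen Ω) (hd : Disjoint s (frontier Ω))
    (hne : (s ∩ Ω).Nonempty) : s ⊆ Ω := by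
  refine hs.subset_left_of_subset_union hΩ isClosed_closure.isOpen_compl
    (disjoint_compl_right_iff_subset.2 subset_closure) (fun x hx => ?_) hne
  by_cases hxc : x ∈ closure Ω
  · rw [closure_eq_self_union_frontier] at hxc
    exact hxc.imp id fun h => absurd h (disjoint_left.1 hd hx)
  · exact Or.inr hxc

/-- A ray that starts in a bounded open set meets the boundary. -/
theorem exists_ray_mem_frontier {n : ℕ} {Ω : Set (RN n)} (hΩ : IsOpen Ω)
    (hb : Bornology.IsBounded Ω) {x e : RN n} (hx : x ∈ Ω) (he : ‖e‖ = 1) :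
    ∃ s : ℝ, 0 ≤ s ∧ x + s • e ∈ frontier Ω := by
  by_contra! hcon
  have hsub : (fun s : ℝ => x + s • e) '' Ici 0 ⊆ Ω := by
    refine ((isPreconnected_Ici).image _ (by fun_prop)).subset_of_disjoint_frontier hΩ ?_
      ⟨x, ⟨0, self_mem_Ici, by simp⟩, hx⟩
    rw [disjoint_left]
    rintro _ ⟨s, hs, rfl⟩
    exact hcon s hs
  obtain ⟨C, hC⟩ := (isBounded_iff_subset_closedBall x).1 hb
  have := hC (hsub ⟨|C| + 1, mem_Ici.2 (by positivity), rfl⟩)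
  rw [mem_closedBall, dist_eq_norm, add_sub_cancel_left, norm_smul, he, mul_one,
    Real.norm_of_nonneg (by positivity)] at this
  linarith [le_abs_self C]

/-- A subsolution that vanishes on the boundary and is at most one grows at most linearly away from
the boundary, with slope `Λ`. -/
theorem IsViscositySubsolution.le_mul_norm_sub {n : ℕ} {Ω : Set (RN n)} (hΩ : IsOpen Ω)
    (hb : Bornology.IsBounded Ω) {Λ : ℝ} (hΛ : 0 < Λ) {u : RN n → ℝ}
    (hc : ContinuousOn u (closure Ω)) (h0 : ∀ x ∈ frontier Ω, u x = 0) (h1 : ∀ x ∈ Ω, u x ≤ 1)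
    (h : IsViscositySubsolution Λ Ω u) {x y : RN n} (hx : x ∈ Ω) (hy : y ∈ frontier Ω) :
    u x ≤ Λ * ‖x - y‖ := by
  obtain ⟨D, hD0, hD⟩ : ∃ D : ℝ, 0 < D ∧ ∀ z ∈ closure Ω, ‖z - y‖ ≤ D := by
    obtain ⟨C, hC⟩ := (isBounded_iff_subset_closedBall y).1 hb.closure
    exact ⟨|C| + 1, by positivity, fun z hz => by
      linarith [mem_closedBall_iff_norm.1 (hC hz), le_abs_self C]⟩
  have key : ∀ b : ℝ, 0 < b → u x ≤ (Λ + 3 * b * D) * ‖x - y‖ := by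
    intro b hb0
    have hbD : 0 < b * D := by positivity
    -- On distances up to `D` the slope `a - 2bt` still exceeds `Λ`, and the concave term makes
    -- `-Δ_∞` positive. With `u ≤ 1`, both entries of the minimum are then positive at an interior
    -- touching point.
    set a := Λ + 3 * b * D with ha
    obtain ⟨z, hz, hmax⟩ := hb.isCompact_closure.exists_isMaxOn ⟨x, subset_closure hx⟩
      (hc.sub (continuous_radialQuadratic 0 a (-b) y).continuousOn)
    have hxz := hmax (subset_closure hx)
    simp only [mem_ofPred_eq, Pi.sub_apply] at hxz
    by_cases hzz : u z - radialQuadratic 0 a (-b) y z ≤ 0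
    · have : radialQuadratic 0 a (-b) y x ≤ a * ‖x - y‖ := by
        rw [radialQuadratic]
        nlinarith [sq_nonneg ‖x - y‖]
      linarith
    · exfalso
      push Not at hzz
      have htD := hD z hz
      have ht0 := norm_nonneg (z - y)
      have hbt : b * ‖z - y‖ ≤ b * D := by gcongr
      have hzΩ : z ∈ Ω := by
        rw [closure_eq_self_union_frontier] at hz
        refine hz.resolve_right fun hzf => hzz.not_ge ?_
        rw [h0 z hzf, radialQuadratic]
        nlinarith
      have hzy : z ≠ y := by
        rintro rfl
        rw [hΩ.frontier_eq] at hy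
        exact hy.2 hzΩ
      have hloc : IsLocalMax (fun w => u w - radialQuadratic 0 a (-b) y w) z :=
        hmax.isLocalMax (Filter.mem_of_superset (hΩ.mem_nhds hzΩ) subset_closure)
      have hvis := h z hzΩ _ (contDiffAt_radialQuadratic 0 a (-b) hzy) hloc
      rw [inftyLaplacian_radialQuadratic 0 a (-b) hzy,
        norm_gradient_radialQuadratic 0 a (-b) hzy] at hvis
      have hgt : Λ < a + 2 * -b * ‖z - y‖ := by linarith
      refine hvis.not_gt (lt_min ?_ ?_)
      · have : 0 < a + 2 * -b * ‖z - y‖ := hΛ.trans hgt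
        have := pow_pos this 2
        nlinarith
      · have := le_abs_self (a + 2 * -b * ‖z - y‖)
        nlinarith [h1 z hzΩ]
  refine le_of_forall_pos_le_add fun ε hε => ?_
  have hE : 0 < 3 * D * ‖x - y‖ + 1 := by positivity
  refine (key (ε / (3 * D * ‖x - y‖ + 1)) (by positivity)).trans ?_
  have : ε / (3 * D * ‖x - y‖ + 1) * (3 * D * ‖x - y‖) ≤ ε := by
    rw [div_mul_eq_mul_div, div_le_iff₀ hE]
    nlinarith
  linarith

theorem IsViscositySupersolution.inftyLaplacian_nonpos {n : ℕ} {Λ : ℝ} {Ω : Set (RN n)}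
    {u : RN n → ℝ} (h : IsViscositySupersolution Λ Ω u) {x : RN n} (hx : x ∈ Ω) {φ : RN n → ℝ}
    (hφ : ContDiffAt ℝ 2 φ x) (hmin : IsLocalMin (fun y => u y - φ y) x) :
    inftyLaplacian φ x ≤ 0 := by
  linarith [(h x hx φ hφ hmin).trans (min_le_left _ _)]

/-- A supersolution that vanishes on the boundary is nonnegative. -/
theorem IsViscositySupersolution.nonneg {n : ℕ} {Ω : Set (RN n)} (hΩ : IsOpen Ω)
    (hb : Bornology.IsBounded Ω) {Λ : ℝ} {u : RN n → ℝ}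
    (hc : ContinuousOn u (closure Ω)) (h0 : ∀ x ∈ frontier Ω, u x = 0)
    (hne : (frontier Ω).Nonempty) (h : IsViscositySupersolution Λ Ω u) :
    ∀ x ∈ closure Ω, 0 ≤ u x := by
  intro x hx
  obtain ⟨y, hy⟩ := hne
  obtain ⟨D, hD0, hD⟩ : ∃ D : ℝ, 0 < D ∧ ∀ z ∈ closure Ω, ‖z - y‖ ≤ D := by
    obtain ⟨C, hC⟩ := (isBounded_iff_subset_closedBall y).1 hb.closure
    exact ⟨|C| + 1, by positivity, fun z hz => by
      linarith [mem_closedBall_iff_norm.1 (hC hz), le_abs_self C]⟩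
  by_contra! hneg
  -- So small a `b` keeps the minimum of `u - b‖· - y‖²` off the boundary; in the interior the test
  -- function has positive `Δ_∞`.
  obtain ⟨b, hb0, hbD⟩ : ∃ b : ℝ, 0 < b ∧ b * D ^ 2 < -u x := by
    refine ⟨-u x / (2 * D ^ 2), div_pos (by linarith) (by positivity), ?_⟩
    field_simp
    linarith
  obtain ⟨z, hz, hmin⟩ := hb.isCompact_closure.exists_isMinOn ⟨x, hx⟩
    (hc.sub (continuous_radialQuadratic 0 0 b y).continuousOn)
  have hxz := hmin hx
  simp only [mem_ofPred_eq, Pi.sub_apply] at hxz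
  have hzΩ : z ∈ Ω := by
    have hz' := hz
    rw [closure_eq_self_union_frontier] at hz'
    refine hz'.resolve_right fun hzf => ?_
    rw [h0 z hzf] at hxz
    simp only [radialQuadratic] at hxz
    have h1 : b * ‖z - y‖ ^ 2 ≤ b * D ^ 2 := by
      gcongr
      exact hD z hz
    have h2 : 0 ≤ b * ‖x - y‖ ^ 2 := by positivity
    linarith
  have hzy : z ≠ y := by
    rintro rfl
    rw [hΩ.frontier_eq] at hy
    exact hy.2 hzΩ
  have hloc : IsLocalMin (fun w => u w - radialQuadratic 0 0 b y w) z :=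
    hmin.isLocalMin (Filter.mem_of_superset (hΩ.mem_nhds hzΩ) subset_closure)
  have hvis := h.inftyLaplacian_nonpos hzΩ (contDiffAt_radialQuadratic 0 0 b hzy) hloc
  rw [inftyLaplacian_radialQuadratic 0 0 b hzy] at hvis
  have hpos : 0 < ‖z - y‖ := norm_pos_iff.2 (sub_ne_zero.2 hzy)
  have : 0 < 2 * b * (0 + 2 * b * ‖z - y‖) ^ 2 := by positivity
  linarith

/-- Comparison from below with the cone that vanishes on the boundary of a ball. -/
theorem IsViscositySupersolution.cone_le {n : ℕ} {Ω : Set (RN n)} {Λ : ℝ} {u : RN n → ℝ}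
    (h : IsViscositySupersolution Λ Ω u) (hc : ContinuousOn u (closure Ω))
    (hu : ∀ x ∈ closure Ω, 0 ≤ u x) {c : RN n} {ρ : ℝ} (hρ : 0 < ρ) (hball : ball c ρ ⊆ Ω)
    (h1 : u c = 1) : ∀ x ∈ closedBall c ρ, 1 - 1 / ρ * ‖x - c‖ ≤ u x := by
  intro x hx
  have hcb : closedBall c ρ ⊆ closure Ω := by
    rw [← closure_ball c hρ.ne']
    exact closure_mono hball
  have key : ∀ b : ℝ, 0 < b → b * ρ < 1 / ρ → 1 - 1 / ρ * ‖x - c‖ ≤ u x + b * (ρ * ‖x - c‖) := by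
    intro b hb hbρ
    -- This `a` makes `1 - at + bt²` vanish at `t = ρ`, and `bρ < 1/ρ` keeps its slope negative up
    -- to there. The minimum can thus only be at `c` or on the sphere.
    set a := 1 / ρ + b * ρ with ha
    obtain ⟨z, hz, hmin⟩ := (isCompact_closedBall c ρ).exists_isMinOn ⟨x, hx⟩
      ((hc.mono hcb).sub (continuous_radialQuadratic 1 (-a) b c).continuousOn)
    have hxz := hmin hx
    simp only [mem_ofPred_eq, Pi.sub_apply] at hxz
    suffices 0 ≤ u z - radialQuadratic 1 (-a) b c z by
      have h2 : 0 ≤ u x - radialQuadratic 1 (-a) b c x := this.trans hxz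
      rw [radialQuadratic] at h2
      have : 0 ≤ b * ‖x - c‖ ^ 2 := by positivity
      linarith
    by_cases hzc : z = c
    · simp [hzc, radialQuadratic, h1]
    rcases (mem_closedBall_iff_norm.1 hz).lt_or_eq with hlt | heq
    · exfalso
      have hloc : IsLocalMin (fun w => u w - radialQuadratic 1 (-a) b c w) z :=
        hmin.isLocalMin (closedBall_mem_nhds_of_mem (mem_ball_iff_norm.2 hlt))
      have hvis := h.inftyLaplacian_nonpos (hball (mem_ball_iff_norm.2 hlt))
        (contDiffAt_radialQuadratic 1 (-a) b hzc) hloc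
      rw [inftyLaplacian_radialQuadratic 1 (-a) b hzc] at hvis
      have hbt : b * ‖z - c‖ ≤ b * ρ := by gcongr
      have hneg : -a + 2 * b * ‖z - c‖ < 0 := by linarith
      have := pow_pos (neg_pos.2 hneg) 2
      rw [neg_sq] at this
      have : 0 < 2 * b * (-a + 2 * b * ‖z - c‖) ^ 2 := by positivity
      linarith
    · have : radialQuadratic 1 (-a) b c z = 0 := by
        rw [radialQuadratic, heq, ha]
        field_simp
        ring
      rw [this, sub_zero]
      exact hu z (hcb hz)
  refine le_of_forall_pos_le_add fun ε hε => ?_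
  set b := min (1 / ρ / (2 * ρ)) (ε / (ρ * ‖x - c‖ + 1)) with hb
  have hb0 : 0 < b := lt_min (by positivity) (by positivity)
  have hb1 : b * ρ < 1 / ρ := by
    calc b * ρ ≤ 1 / ρ / (2 * ρ) * ρ := by gcongr; exact min_le_left _ _
      _ = 1 / ρ / 2 := by field_simp
      _ < 1 / ρ := half_lt_self (by positivity)
  have hb2 : b * (ρ * ‖x - c‖) ≤ ε := by
    have hE : 0 < ρ * ‖x - c‖ + 1 := by positivity
    calc b * (ρ * ‖x - c‖) ≤ ε / (ρ * ‖x - c‖ + 1) * (ρ * ‖x - c‖) := by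
          gcongr; exact min_le_right _ _
      _ ≤ ε := by
          rw [div_mul_eq_mul_div, div_le_iff₀ hE]
          nlinarith
  linarith [key b hb0 hb1]

/-! ### The cone as ground state of the ball -/

theorem cone_eq_radialQuadratic {n : ℕ} (c : RN n) (r : ℝ) :
    (fun x : RN n => 1 - ‖x - c‖ / r) = radialQuadratic 1 (-(1 / r)) 0 c := by
  ext x
  rw [radialQuadratic]
  ring

/-- At a point different from the vertex, a test function touching the cone has the gradient of
the cone. -/
theorem gradient_eq_of_isLocalExtr_cone_sub {n : ℕ} {c x : RN n} {r : ℝ} {φ : RN n → ℝ}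
    (hx : x ≠ c) (hφ : ContDiffAt ℝ 2 φ x)
    (h : IsLocalExtr (fun y => (1 - ‖y - c‖ / r) - φ y) x) :
    ∇ φ x = ∇ (radialQuadratic 1 (-(1 / r)) 0 c) x := by
  have h1 := hasFDerivAt_radialQuadratic 1 (-(1 / r)) 0 hx
  rw [← cone_eq_radialQuadratic] at h1
  have h2 : HasFDerivAt φ (fderiv ℝ φ x) x := (hφ.differentiableAt (by simp)).hasFDerivAt
  have h3 := h.hasFDerivAt_eq_zero (h1.sub h2)
  rw [← cone_eq_radialQuadratic, gradient, gradient, h1.fderiv, sub_eq_zero.1 h3]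

/-- The cone is affine along the line through its vertex. -/
theorem cone_ray {n : ℕ} {c x : RN n} {r κ : ℝ} :
    ∀ᶠ s : ℝ in 𝓝 0, 1 - ‖x + s • κ • (x - c) - c‖ / r
      = (1 - ‖x - c‖ / r) + (-(κ * ‖x - c‖ / r)) * s := by
  have hc : ∀ᶠ s : ℝ in 𝓝 0, 0 < 1 + s * κ :=
    ((by fun_prop : Continuous fun s : ℝ => 1 + s * κ).tendsto' 0 1 (by simp)).eventually_const_lt
      zero_lt_one
  filter_upwards [hc] with s hs
  have e : x + s • κ • (x - c) - c = (1 + s * κ) • (x - c) := by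
    rw [add_smul, one_smul, mul_smul]
    abel
  rw [e, norm_smul, Real.norm_of_nonneg hs.le]
  ring

/-- The cone is a ground state of the ball. -/
theorem isNormalizedGroundState_cone {n : ℕ} (hn : 1 ≤ n) (c : RN n) {r : ℝ} (hr : 0 < r) :
    IsNormalizedGroundState (ball c r) (fun x => 1 - ‖x - c‖ / r) where
  continuousOn := by fun_prop
  boundary := cone_eq_zero_of_mem_frontier hr
  norm_eq_one := eLpNorm_cone c hr
  subsolution := by
    intro x hx φ hφ h
    rw [dirichletInftyEigenvalue_ball hn c hr]
    by_cases hxc : x = c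
    · subst hxc
      -- At the vertex a test function above the cone has gradient of norm at most `1 / r`, which is
      -- `Λ` times the value 1.
      refine (min_le_right _ _).trans ?_
      have hd : HasFDerivAt φ (fderiv ℝ φ x) x := (hφ.differentiableAt (by simp)).hasFDerivAt
      have hev : ∀ᶠ y in 𝓝 x, φ x - 1 / r * ‖y - x‖ ≤ φ y := by
        filter_upwards [h] with y hy
        simp only [sub_self, norm_zero, zero_div, sub_zero] at hy
        rw [div_mul_eq_mul_div, one_mul]
        linarith
      have h1 := hd.neg_mul_norm_le hev (-∇ φ x)
      have h2 : fderiv ℝ φ x (-∇ φ x) = -‖∇ φ x‖ ^ 2 := by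
        rw [map_neg, ← real_inner_self_eq_norm_sq]
        nth_rewrite 2 [gradient]
        rw [InnerProductSpace.toDual_symm_apply]
      rw [h2, norm_neg, neg_le_neg_iff, sq] at h1
      simp only [sub_self, norm_zero, zero_div, sub_zero, mul_one]
      by_contra! hcon
      have : 0 < 1 / r := by positivity
      nlinarith
    · refine (min_le_left _ _).trans ?_
      have hg := gradient_eq_of_isLocalExtr_cone_sub hxc hφ (Or.inr h)
      rw [gradient_radialQuadratic _ _ _ hxc] at hg
      rw [inftyLaplacian, hg, neg_nonpos]
      exact IsLocalMax.fderiv_fderiv_nonneg hφ h cone_ray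
  supersolution := by
    intro x hx φ hφ h
    rw [dirichletInftyEigenvalue_ball hn c hr]
    by_cases hxc : x = c
    -- No differentiable function touches the cone from below at its vertex: its derivatives along
    -- `e` and `-e` would both be negative.
    · exfalso
      subst hxc
      obtain ⟨e, he, -⟩ := exists_unit_smul_eq hn (0 : RN n)
      have hd : HasFDerivAt (fun y => -φ y) (-fderiv ℝ φ x) x :=
        (hφ.differentiableAt (by simp)).hasFDerivAt.neg
      have hev : ∀ᶠ y in 𝓝 x, -φ x - -(1 / r) * ‖y - x‖ ≤ -φ y := by
        filter_upwards [h] with y hy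
        simp only [sub_self, norm_zero, zero_div, sub_zero] at hy
        rw [neg_mul, div_mul_eq_mul_div, one_mul]
        linarith
      have h1 := hd.neg_mul_norm_le hev e
      have h2 := hd.neg_mul_norm_le hev (-e)
      rw [map_neg, norm_neg] at h2
      rw [he] at h1 h2
      have : 0 < 1 / r := by positivity
      linarith
    · have hg := gradient_eq_of_isLocalExtr_cone_sub hxc hφ (Or.inl h)
      refine le_min ?_ ?_
      · rw [gradient_radialQuadratic _ _ _ hxc] at hg
        rw [inftyLaplacian, hg, neg_nonneg]
        exact IsLocalMin.fderiv_fderiv_nonpos hφ h cone_ray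
      · rw [hg, norm_gradient_radialQuadratic _ _ _ hxc, mul_zero, zero_mul, add_zero, abs_neg,
          abs_of_pos (by positivity)]
        have h1 : 0 ≤ ‖x - c‖ / r := by positivity
        have h2 : 0 < 1 / r := by positivity
        nlinarith

/-! ### Two-sided bounds for ground states -/

namespace IsNormalizedGroundState

variable {n : ℕ} {Ω : Set (RN n)} {u : RN n → ℝ}

theorem abs_le_one (h : IsNormalizedGroundState Ω u) (hΩ : IsOpen Ω) : ∀ x ∈ Ω, |u x| ≤ 1 := by
  have hc : ContinuousOn u Ω := h.continuousOn.mono subset_closure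
  have hm : MemLp u ∞ (volume.restrict Ω) :=
    ⟨hc.aestronglyMeasurable hΩ.measurableSet, by simp [h.norm_eq_one]⟩
  have := hm.ae_norm_le_toReal_eLpNorm_top
  rw [h.norm_eq_one, ENNReal.toReal_one] at this
  exact hc.norm.le_of_ae_restrict_le hΩ this

theorem exists_eq_one (h : IsNormalizedGroundState Ω u) (hΩ : IsOpen Ω)
    (hb : Bornology.IsBounded Ω) (hne : Ω.Nonempty) (hu : ∀ x ∈ closure Ω, 0 ≤ u x) :
    ∃ x ∈ Ω, u x = 1 := by
  obtain ⟨z, hz, hmax⟩ := hb.isCompact_closure.exists_isMaxOn hne.closure h.continuousOn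
  have hle : eLpNorm u ∞ (volume.restrict Ω) ≤ ENNReal.ofReal (u z) := by
    rw [eLpNorm_exponent_top]
    refine eLpNormEssSup_le_of_ae_bound ?_
    filter_upwards [ae_restrict_mem hΩ.measurableSet] with x hx
    rw [Real.norm_of_nonneg (hu x (subset_closure hx))]
    exact hmax (subset_closure hx)
  rw [h.norm_eq_one, ENNReal.one_le_ofReal] at hle
  have hzΩ : z ∈ Ω := by
    rw [closure_eq_self_union_frontier] at hz
    refine hz.resolve_right fun hzf => ?_
    rw [h.boundary z hzf] at hle
    linarith
  exact ⟨z, hzΩ, le_antisymm ((abs_le.1 (h.abs_le_one hΩ z hzΩ)).2) hle⟩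

/-- Two-sided bounds for a ground state in terms of the diameter of the domain and the distance
to the centre of a largest ball. -/
theorem bounds (h : IsNormalizedGroundState Ω u) (hn : 1 ≤ n) (hΩ : IsOpen Ω)
    (hb : Bornology.IsBounded Ω) {Λ : ℝ} (hΛ : 0 < Λ)
    (hΛe : dirichletInftyEigenvalue Ω = Λ) {M : ℝ} (hM : ∀ y ∈ Ω, ∀ z ∈ Ω, ‖y - z‖ ≤ M)
    {x₀ : RN n} (hx₀ : IsIncenter Ω x₀) {x : RN n} (hx : x ∈ Ω) :
    3 - Λ * M - Λ * ‖x - x₀‖ ≤ u x ∧ u x ≤ Λ * M - 1 - Λ * ‖x - x₀‖ := by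
  have hsub := h.subsolution
  have hsup := h.supersolution
  rw [hΛe] at hsub hsup
  have hfne : (frontier Ω).Nonempty := by
    obtain ⟨e, he, -⟩ := exists_unit_smul_eq hn (0 : RN n)
    obtain ⟨s, -, hs⟩ := exists_ray_mem_frontier hΩ hb hx he
    exact ⟨_, hs⟩
  have hu0 := hsup.nonneg hΩ hb h.continuousOn h.boundary hfne
  obtain ⟨c, hc, huc⟩ := h.exists_eq_one hΩ hb ⟨x, hx⟩ hu0
  have hup : ∀ z ∈ Ω, ∀ y ∈ frontier Ω, u z ≤ Λ * ‖z - y‖ := fun z hz y hy =>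
    hsub.le_mul_norm_sub hΩ hb hΛ h.continuousOn h.boundary
      (fun w hw => (abs_le.1 (h.abs_le_one hΩ w hw)).2) hz hy
  have hcd : 1 / Λ ≤ infDist c (frontier Ω) := by
    refine (le_infDist hfne).2 fun y hy => ?_
    rw [div_le_iff₀ hΛ, dist_eq_norm, mul_comm, ← huc]
    exact hup c hc y hy
  have hball : ∀ z ∈ Ω, 1 / Λ ≤ infDist z (frontier Ω) → ball z (1 / Λ) ⊆ Ω := by
    intro z hz hd
    refine (convex_ball z _).isPreconnected.subset_of_disjoint_frontier hΩ ?_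
      ⟨z, mem_ball_self (by positivity), hz⟩
    rw [disjoint_left]
    intro w hw hwf
    have := infDist_le_dist_of_mem (x := z) hwf
    rw [mem_ball, dist_comm] at hw
    linarith
  have hBc := hball c hc hcd
  have hB0 := hball x₀ hx₀.1 (hcd.trans (hx₀.2 c hc))
  have hmem : ∀ (z e : RN n) (s : ℝ), ‖e‖ = 1 → 0 < s → s < 1 / Λ → z + s • e ∈ ball z (1 / Λ) ∧
      z - s • e ∈ ball z (1 / Λ) := by
    intro z e s he hs hs1
    have : ‖s • e‖ < 1 / Λ := by rwa [norm_smul, he, mul_one, Real.norm_of_nonneg hs.le]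
    simpa [mem_ball_iff_norm] using this
  -- The diameter bound is applied to `y` and points of the ball at `x₀` on the far side from `y`.
  have hfar : ∀ y ∈ Ω, ‖y - x₀‖ + 1 / Λ ≤ M := by
    intro y hy
    obtain ⟨e, he, hye⟩ := exists_unit_smul_eq hn (y - x₀)
    refine le_of_forall_pos_le_add fun ε hε => ?_
    obtain ⟨s, hs, hs1⟩ := exists_between (max_lt (show (0 : ℝ) < 1 / Λ by positivity)
      (sub_lt_self (1 / Λ) hε))
    have hs0 := (le_max_left _ _).trans_lt hs
    have hsε := (le_max_right _ _).trans_lt hs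
    have h1 := hM y hy _ (hB0 (hmem x₀ e s he hs0 hs1).2)
    have h2 : y - (x₀ - s • e) = (‖y - x₀‖ + s) • e := by
      rw [add_smul, ← hye]
      abel
    rw [h2, norm_smul, he, mul_one, Real.norm_of_nonneg (by positivity)] at h1
    linarith
  -- The far ends of the two balls, on the line of centres, are almost `‖x₀ - c‖ + 2/Λ` apart.
  have hcc : ‖x₀ - c‖ + 2 / Λ ≤ M := by
    obtain ⟨e, he, hye⟩ := exists_unit_smul_eq hn (x₀ - c)
    refine le_of_forall_pos_le_add fun ε hε => ?_
    obtain ⟨s, hs, hs1⟩ := exists_between (max_lt (show (0 : ℝ) < 1 / Λ by positivity)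
      (sub_lt_self (1 / Λ) (half_pos hε)))
    have hs0 := (le_max_left _ _).trans_lt hs
    have hsε := (le_max_right _ _).trans_lt hs
    have h1 := hM _ (hB0 (hmem x₀ e s he hs0 hs1).1) _ (hBc (hmem c e s he hs0 hs1).2)
    have h2 : x₀ + s • e - (c - s • e) = (‖x₀ - c‖ + s + s) • e := by
      rw [add_smul, add_smul, ← hye]
      abel
    rw [h2, norm_smul, he, mul_one, Real.norm_of_nonneg (by positivity)] at h1
    have : 2 / Λ = 1 / Λ + 1 / Λ := by ring
    linarith
  constructor
  · have hcone : 1 - Λ * ‖x - c‖ ≤ u x := by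
      by_cases hxc : x ∈ closedBall c (1 / Λ)
      · simpa using hsup.cone_le h.continuousOn hu0 (by positivity) hBc huc x hxc
      -- Outside the ball the cone is negative and `u ≥ 0` suffices.
      · rw [mem_closedBall_iff_norm, not_le, div_lt_iff₀ hΛ] at hxc
        linarith [hu0 x (subset_closure hx)]
    have h1 : ‖x - c‖ ≤ ‖x - x₀‖ + ‖x₀ - c‖ := norm_sub_le_norm_sub_add_norm_sub x x₀ c
    have h2 := mul_le_mul_of_nonneg_left h1 hΛ.le
    have h3 := mul_le_mul_of_nonneg_left hcc hΛ.le
    have h4 : Λ * (2 / Λ) = 2 := by field_simp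
    linarith
  · obtain ⟨e, he, hxe⟩ := exists_unit_smul_eq hn (x - x₀)
    obtain ⟨s, hs, hsf⟩ := exists_ray_mem_frontier hΩ hb hx he
    have h1 := hup x hx _ hsf
    have h2 : ‖x - (x + s • e)‖ = s := by
      rw [sub_add_cancel_left, norm_neg, norm_smul, he, mul_one, Real.norm_of_nonneg hs]
    have h3 : ‖x + s • e - x₀‖ = ‖x - x₀‖ + s := by
      have : x + s • e - x₀ = (‖x - x₀‖ + s) • e := by
        rw [add_smul, ← hxe]
        abel
      rw [this, norm_smul, he, mul_one, Real.norm_of_nonneg (by positivity)]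
    have h4 : ‖x + s • e - x₀‖ + 1 / Λ ≤ M :=
      le_on_closure hfar (by fun_prop) continuousOn_const (frontier_subset_closure hsf)
    rw [h3] at h4
    rw [h2] at h1
    have h5 := mul_le_mul_of_nonneg_left h4 hΛ.le
    have h6 : Λ * (1 / Λ) = 1 := by field_simp
    linarith

end IsNormalizedGroundState

/-! ### The stability theorem -/

theorem theorem1p3 (n : ℕ) (hn : 1 ≤ n) (r : ℝ) (hr : 0 < r) :
    (∀ x₀ : RN n, IsNormalizedGroundState (ball x₀ r) (fun x => 1 - ‖x - x₀‖ / r)) ∧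
    ∀ ε : ℝ, 0 < ε → ∃ δ₁ : ℝ, 0 < δ₁ ∧ ∃ δ₂ : ℝ, 0 < δ₂ ∧
      ∀ Ω : Set (RN n), IsOpen Ω → IsConnected Ω → Bornology.IsBounded Ω →
        volume Ω = volume (ball (0 : RN n) r) →
        |dirichletInftyEigenvalue Ω - dirichletInftyEigenvalue (ball (0 : RN n) r)| < δ₁ →
        |neumannInftyEigenvalue Ω - neumannInftyEigenvalue (ball (0 : RN n) r)| < δ₂ →
        ∀ x₀ : RN n, IsIncenter Ω x₀ →
          ∀ u : RN n → ℝ, IsNormalizedGroundState Ω u →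
            ∀ x ∈ Ω ∩ ball x₀ r, |u x - (1 - ‖x - x₀‖ / r)| < ε := by
  refine ⟨fun x₀ => isNormalizedGroundState_cone hn x₀ hr, fun ε hε => ?_⟩
  -- The error is `8η` from `ΛM ≤ 2(1 + η)/(1 - η) ≤ 2 + 8η`, where `η ≤ 1/2` enters, plus `η` from
  -- replacing `Λ` by `1 / r`.
  obtain ⟨η, hη0, hη2, hηε⟩ : ∃ η : ℝ, 0 < η ∧ η ≤ 1 / 2 ∧ 9 * η < ε := by
    refine ⟨min (1 / 2) (ε / 10), by positivity, min_le_left _ _, ?_⟩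
    linarith [min_le_right (1 / 2) (ε / 10)]
  refine ⟨η / r, by positivity, η / r, by positivity, ?_⟩
  intro Ω hΩ _ hb _ hD hN x₀ hx₀ u hu x ⟨hx, hxr⟩
  rw [dirichletInftyEigenvalue_ball hn 0 hr] at hD
  have hNb := one_div_le_neumannInftyEigenvalue_ball hn (0 : RN n) hr
  set Λ := dirichletInftyEigenvalue Ω with hΛe
  have hΛr : |Λ * r - 1| < η := by
    have : Λ * r - 1 = (Λ - 1 / r) * r := by field_simp
    rw [this, abs_mul, abs_of_pos hr]
    rwa [lt_div_iff₀ hr] at hD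
  obtain ⟨hl, hg⟩ := abs_lt.1 hΛr
  have hΛ : 0 < Λ := pos_of_mul_pos_left (by linarith) hr.le
  have hη1 : 0 < 1 - η := by linarith
  have hM : ∀ y ∈ Ω, ∀ z ∈ Ω, ‖y - z‖ ≤ 2 * r / (1 - η) := by
    intro y hy z hz
    by_cases hyz : y = z
    · rw [hyz, sub_self, norm_zero]
      positivity
    have h1 := neumannInftyEigenvalue_le hΩ hb hy hz hyz
    have h2 := (abs_lt.1 hN).1
    have hpos : 0 < ‖y - z‖ := norm_pos_iff.2 (sub_ne_zero.2 hyz)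
    have h3 : (1 - η) / r ≤ 2 / ‖y - z‖ := by
      rw [sub_div]
      linarith
    rw [div_le_div_iff₀ hr hpos] at h3
    rw [le_div_iff₀ hη1]
    linarith
  obtain ⟨hlo, hhi⟩ := hu.bounds hn hΩ hb hΛ hΛe.symm hM hx₀ hx
  have hΛM : Λ * (2 * r / (1 - η)) ≤ 2 + 8 * η := by
    rw [← mul_div_assoc, div_le_iff₀ hη1]
    nlinarith
  have hdiff : |Λ * ‖x - x₀‖ - ‖x - x₀‖ / r| ≤ η := by
    have h1 : Λ * ‖x - x₀‖ - ‖x - x₀‖ / r = (Λ * r - 1) * (‖x - x₀‖ / r) := by field_simp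
    have h2 : ‖x - x₀‖ / r ≤ 1 := (div_le_one hr).2 (mem_ball_iff_norm.1 hxr).le
    rw [h1, abs_mul, abs_of_nonneg (by positivity : 0 ≤ ‖x - x₀‖ / r)]
    calc |Λ * r - 1| * (‖x - x₀‖ / r) ≤ η * 1 := by gcongr
      _ = η := mul_one _
  obtain ⟨hd1, hd2⟩ := abs_le.1 hdiff
  rw [abs_lt]
  constructor <;> linarith
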